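/- Fix a real number $a\in(0,2]$. For each integer $n\ge 2$, let $\nu_{n,a}$ be the number of complex roots of the trinomial $x^n-ax-1$, counted with multiplicity, whose modulus is greater than $1$. Then \[ \lim_{n\to\infty}\frac{\nu_{n,a}}{n}=\frac{1}{\pi}\arccos\left(-\frac a2\right). \] -/

import Mathlib

open Polynomial Filter Topology

noncomputable section

/-- The trinomial `x ^ n - a x - 1` with real parameter `a`, as a complex polynomial. -/
def trinomial (n : ℕ) (a : ℝ) : ℂ[X] :=
  X ^ n - C (a : ℂ) * X - 1

/-- The number of complex roots of `x ^ n - a x - 1`, counted with multiplicity, of modulus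
greater than `1`. -/
def nu (n : ℕ) (a : ℝ) : ℕ :=
  Multiset.card ((trinomial n a).roots.filter fun z : ℂ => 1 < ‖z‖)

end

open MeasureTheory

/-! The roots equidistribute on the unit circle. Newton's identities make their power sums of order
`1, …, n - 2` vanish. The moduli have product `1`, and `|z|^n = |1 + a z| ≤ 7` at each root, so `∑
|log ‖z i‖|` is bounded independently of `n` (`trinomial_sum_abs_log`). Replacing `z^(d+k) z̄^k` by
`z^d` therefore costs `O(1)` in the sum, and the normalised mixed moments tend to those of the
circle (`trinomial_tendsto_moment`). By Stone–Weierstrass this is weak convergence. Finally, a root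
has `|z| > 1` iff `|1 + a z| > 1`, a condition that no longer involves `n` and whose frontier is
null for the circle measure. The portmanteau theorem leaves the length of the arc `cos θ > -a/2`. -/

/-! ### Coefficients and power sums of the roots -/

theorem sum_pow_eq_zero_of_esymm_eq_zero {ι R : Type*} [Fintype ι] [CommRing R] (z : ι → R)
    {k : ℕ} (hk : 0 < k)
    (h : ∀ i, 0 < i → i ≤ k → (Finset.univ.val.map z).esymm i = 0) :
    ∑ i, z i ^ k = 0 := by
  classical
  have key := congrArg (MvPolynomial.aeval z) (MvPolynomial.psum_eq_mul_esymm_sub_sum ι R k hk)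
  have h1 : MvPolynomial.aeval z (MvPolynomial.psum ι R k) = ∑ i, z i ^ k := by
    simp [MvPolynomial.psum]
  rw [h1, map_sub, map_mul, map_sum, MvPolynomial.aeval_esymm_eq_multiset_esymm, h k hk le_rfl,
    mul_zero, zero_sub] at key
  rw [key, neg_eq_zero]
  refine Finset.sum_eq_zero fun p hp => ?_
  simp only [Finset.mem_filter, Set.mem_Ioo] at hp
  rw [map_mul, map_mul, MvPolynomial.aeval_esymm_eq_multiset_esymm, h p.1 hp.2.1 hp.2.2.le]
  simp

theorem natDegree_pow_sub_trinomial {n : ℕ} (hn : 2 ≤ n) (a : ℝ) : (trinomial n a).natDegree = n := by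
  unfold _root_.trinomial
  rw [sub_sub]
  rw [natDegree_sub_eq_left_of_natDegree_lt] <;> rw [natDegree_X_pow]
  refine lt_of_le_of_lt (b := 1) ?_ (by omega)
  compute_degree

theorem monic_pow_sub_trinomial {n : ℕ} (hn : 2 ≤ n) (a : ℝ) : (trinomial n a).Monic := by
  unfold _root_.trinomial
  rw [sub_sub]
  refine monic_X_pow_sub (n := n) (lt_of_le_of_lt (b := 1) ?_ (by exact_mod_cast hn))
  compute_degree

theorem trinomial_card_roots (n : ℕ) (a : ℝ) :
    Multiset.card (trinomial n a).roots = (trinomial n a).natDegree :=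
  splits_iff_card_roots.1 (IsAlgClosed.splits _)

theorem trinomial_exists_roots {n : ℕ} (hn : 2 ≤ n) (a : ℝ) :
    ∃ z : Fin n → ℂ, Finset.univ.val.map z = (trinomial n a).roots := by
  have hc := trinomial_card_roots n a
  rw [natDegree_pow_sub_trinomial hn] at hc
  obtain ⟨l, hl⟩ := Quot.exists_rep (trinomial n a).roots
  have hl' : (l : Multiset ℂ) = (trinomial n a).roots := hl
  rw [← hl', Multiset.coe_card] at hc
  subst hc
  refine ⟨l.get, ?_⟩
  rw [← hl', Fin.univ_val_map, List.ofFn_get]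

/-- Vieta: the trinomial has no terms of degree strictly between `1` and `n`. -/
theorem trinomial_esymm_roots {n : ℕ} (a : ℝ) {i : ℕ} (hi : 0 < i) (hin : i + 2 ≤ n) :
    (trinomial n a).roots.esymm i = 0 := by
  have hn : 2 ≤ n := by omega
  have h := coeff_eq_esymm_roots_of_card (trinomial_card_roots n a) (k := n - i)
    (by rw [natDegree_pow_sub_trinomial hn]; omega)
  rw [natDegree_pow_sub_trinomial hn, (monic_pow_sub_trinomial hn a).leadingCoeff, one_mul,
    show n - (n - i) = i by omega] at h
  have h0 : (trinomial n a).coeff (n - i) = 0 := by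
    simp only [_root_.trinomial, coeff_sub, coeff_X_pow, coeff_C_mul, coeff_X, coeff_one]
    rw [if_neg (by omega), if_neg (by omega), if_neg (by omega)]
    simp
  rw [h0] at h
  have := mul_eq_zero.1 h.symm
  simpa using this

theorem trinomial_sum_pow {n : ℕ} {a : ℝ} {z : Fin n → ℂ}
    (hz : Finset.univ.val.map z = (trinomial n a).roots) {k : ℕ} (hk : 0 < k) (hkn : k + 2 ≤ n) :
    ∑ i, z i ^ k = 0 := by
  refine sum_pow_eq_zero_of_esymm_eq_zero z hk fun i hi hik => ?_
  rw [hz]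
  exact trinomial_esymm_roots a hi (by omega)

theorem trinomial_prod_norm {n : ℕ} (hn : 2 ≤ n) {a : ℝ} {z : Fin n → ℂ}
    (hz : Finset.univ.val.map z = (trinomial n a).roots) : ∏ i, ‖z i‖ = 1 := by
  have h := (IsAlgClosed.splits (trinomial n a)).coeff_zero_eq_prod_roots_of_monic
    (monic_pow_sub_trinomial hn a)
  have h0 : (trinomial n a).coeff 0 = (-1 : ℂ) := by
    have : n ≠ 0 := by omega
    simp [_root_.trinomial, coeff_X_pow, this.symm]
  have hprod : (trinomial n a).roots.prod = ∏ i, z i := by rw [← hz]; rfl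
  have h2 := congrArg norm (h0.symm.trans h)
  rw [norm_mul, norm_pow, norm_neg, norm_one, one_pow, one_mul, hprod, norm_prod] at h2
  exact h2.symm

theorem trinomial_root_eq {n : ℕ} {a : ℝ} {z : Fin n → ℂ}
    (hz : Finset.univ.val.map z = (trinomial n a).roots) (i : Fin n) :
    z i ^ n = 1 + a * z i := by
  have hi : z i ∈ (trinomial n a).roots := by
    rw [← hz]
    exact Multiset.mem_map_of_mem z (Finset.mem_univ_val i)
  have := (mem_roots'.1 hi).2
  simp only [_root_.trinomial, IsRoot.def, eval_sub, eval_pow, eval_X, eval_mul, eval_C, eval_one] at this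
  linear_combination this

/-! ### Closeness of the roots to the unit circle -/

theorem norm_le_three_of_pow_eq {n : ℕ} (hn : 2 ≤ n) {a : ℝ} (ha : a ∈ Set.Ioc (0 : ℝ) 2) {z : ℂ}
    (hz : z ^ n = 1 + a * z) : ‖z‖ ≤ 3 := by
  by_contra! h
  have h1 : ‖z‖ ^ n ≤ 1 + 2 * ‖z‖ := by
    rw [← norm_pow, hz]
    refine (norm_add_le _ _).trans ?_
    rw [norm_one, norm_mul, Complex.norm_real, Real.norm_of_nonneg ha.1.le]
    gcongr
    exact ha.2
  have h2 : ‖z‖ ^ 2 ≤ ‖z‖ ^ n := pow_le_pow_right₀ (by linarith) hn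
  nlinarith

theorem posLog_norm_le_of_pow_eq {n : ℕ} (hn : 2 ≤ n) {a : ℝ} (ha : a ∈ Set.Ioc (0 : ℝ) 2) {z : ℂ}
    (hz : z ^ n = 1 + a * z) : max (Real.log ‖z‖) 0 ≤ Real.log 7 / n := by
  have hn' : (0 : ℝ) < n := by exact_mod_cast (by omega : 0 < n)
  refine max_le ?_ (div_nonneg (Real.log_nonneg (by norm_num)) hn'.le)
  rw [le_div_iff₀ hn', mul_comm, ← Real.log_pow]
  have h3 := norm_le_three_of_pow_eq hn ha hz
  have h1 : ‖z‖ ^ n ≤ 7 := by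
    rw [← norm_pow, hz]
    refine (norm_add_le _ _).trans ?_
    rw [norm_one, norm_mul, Complex.norm_real, Real.norm_of_nonneg ha.1.le]
    nlinarith [ha.1, ha.2, norm_nonneg z]
  rcases (norm_nonneg z).eq_or_lt with h0 | h0
  -- At zero the default `Real.log 0 = 0` settles the bound.
  · rw [← h0, zero_pow (by omega), Real.log_zero]
    exact Real.log_nonneg (by norm_num)
  · exact Real.log_le_log (by positivity) h1

/-- The logarithms sum to `0`, so the sum of absolute values is twice that of the positive parts,
each at most `log 7 / n`. -/
theorem trinomial_sum_abs_log {n : ℕ} (hn : 2 ≤ n) {a : ℝ} (ha : a ∈ Set.Ioc (0 : ℝ) 2)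
    {z : Fin n → ℂ} (hz : Finset.univ.val.map z = (trinomial n a).roots) :
    ∑ i, |Real.log ‖z i‖| ≤ 2 * Real.log 7 := by
  have hp := trinomial_prod_norm hn hz
  have hne : ∀ i ∈ Finset.univ, ‖z i‖ ≠ 0 := by
    refine Finset.prod_ne_zero_iff.1 ?_
    rw [hp]
    exact one_ne_zero
  have h0 : ∑ i, Real.log ‖z i‖ = 0 := by
    rw [← Real.log_prod hne, hp, Real.log_one]
  have hn' : (n : ℝ) ≠ 0 := by exact_mod_cast (by omega : n ≠ 0)
  calc ∑ i, |Real.log ‖z i‖| = ∑ i, (2 * max (Real.log ‖z i‖) 0 - Real.log ‖z i‖) := by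
        refine Finset.sum_congr rfl fun i _ => ?_
        rcases le_total (Real.log ‖z i‖) 0 with h | h
        · rw [abs_of_nonpos h, max_eq_right h]; ring
        · rw [abs_of_nonneg h, max_eq_left h]; ring
    _ = 2 * ∑ i, max (Real.log ‖z i‖) 0 := by
        rw [Finset.sum_sub_distrib, h0, sub_zero, Finset.mul_sum]
    _ ≤ 2 * ∑ _i : Fin n, Real.log 7 / n := by
        gcongr with i
        exact posLog_norm_le_of_pow_eq hn ha (trinomial_root_eq hz i)
    _ = 2 * Real.log 7 := by
        rw [Finset.sum_const, Finset.card_univ, Fintype.card_fin, nsmul_eq_mul]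
        field_simp

theorem abs_pow_sub_one_le {r : ℝ} (h0 : 0 < r) (h3 : r ≤ 3) (m : ℕ) :
    |r ^ m - 1| ≤ m * 3 ^ m * |Real.log r| := by
  have hexp : r ^ m = Real.exp (m * Real.log r) := by
    rw [← Real.log_pow, Real.exp_log (by positivity)]
  have h3m : (1 : ℝ) ≤ 3 ^ m := one_le_pow₀ (by norm_num)
  rcases le_total r 1 with h | h
  · have hl : Real.log r ≤ 0 := Real.log_nonpos h0.le h
    have := Real.add_one_le_exp (m * Real.log r)
    have hm : r ^ m ≤ 1 := pow_le_one₀ h0.le h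
    rw [abs_of_nonpos (by linarith), abs_of_nonpos hl]
    have h5 : 0 ≤ m * (-Real.log r) := mul_nonneg (Nat.cast_nonneg _) (by linarith)
    nlinarith
  · have hl : 0 ≤ Real.log r := Real.log_nonneg h
    have hm : 1 ≤ r ^ m := one_le_pow₀ h
    rw [abs_of_nonneg (by linarith), abs_of_nonneg hl]
    have h6 : r ^ m ≤ 3 ^ m := pow_le_pow_left₀ h0.le h3 m
    -- With `t = m log r`, multiplying `1 - t ≤ e^(-t)` by `r^m = e^t` gives `r^m - 1 ≤ t r^m`.
    have h7 := Real.add_one_le_exp (-(m * Real.log r))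
    rw [Real.exp_neg, ← hexp] at h7
    have h8 : r ^ m * (r ^ m)⁻¹ = 1 := mul_inv_cancel₀ (by positivity)
    have h9 : 0 ≤ m * Real.log r := mul_nonneg (Nat.cast_nonneg _) hl
    have h10 := mul_le_mul_of_nonneg_left h7 (by positivity : 0 ≤ r ^ m)
    nlinarith

/-! ### Mixed moments of the roots -/

theorem pow_add_mul_conj_pow (z : ℂ) (d k : ℕ) :
    z ^ (d + k) * (starRingEnd ℂ z) ^ k = z ^ d * ((‖z‖ ^ (2 * k) : ℝ) : ℂ) := by
  rw [pow_add, mul_assoc, ← mul_pow, Complex.mul_conj, Complex.normSq_eq_norm_sq, pow_mul]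
  push_cast
  rfl

theorem trinomial_sum_mixed_moment_sub_le {n : ℕ} (hn : 2 ≤ n) {a : ℝ}
    (ha : a ∈ Set.Ioc (0 : ℝ) 2) {z : Fin n → ℂ}
    (hz : Finset.univ.val.map z = (trinomial n a).roots) (d k : ℕ) :
    ‖∑ i, z i ^ (d + k) * (starRingEnd ℂ (z i)) ^ k - ∑ i, z i ^ d‖ ≤
      3 ^ d * (((2 * k : ℕ) : ℝ) * 3 ^ (2 * k)) * (2 * Real.log 7) := by
  rw [← Finset.sum_sub_distrib]
  have hne : ∀ i ∈ Finset.univ, ‖z i‖ ≠ 0 := by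
    refine Finset.prod_ne_zero_iff.1 ?_
    rw [trinomial_prod_norm hn hz]
    exact one_ne_zero
  calc _ ≤ ∑ i, 3 ^ d * (((2 * k : ℕ) : ℝ) * 3 ^ (2 * k)) * |Real.log ‖z i‖| := by
        refine norm_sum_le_of_le _ fun i _ => ?_
        have h3 := norm_le_three_of_pow_eq hn ha (trinomial_root_eq hz i)
        have h0 : 0 < ‖z i‖ := (norm_nonneg _).lt_of_ne' (hne i (Finset.mem_univ i))
        rw [pow_add_mul_conj_pow, ← mul_sub_one, norm_mul, norm_pow, mul_assoc]
        have : ‖((‖z i‖ ^ (2 * k) : ℝ) : ℂ) - 1‖ = |‖z i‖ ^ (2 * k) - 1| := by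
          rw [← Complex.ofReal_one, ← Complex.ofReal_sub, Complex.norm_real, Real.norm_eq_abs]
        rw [this]
        gcongr
        exact abs_pow_sub_one_le h0 h3 _
    _ ≤ _ := by
        rw [← Finset.mul_sum]
        gcongr
        exact trinomial_sum_abs_log hn ha hz

theorem tendsto_div_nat_of_norm_sub_le {u : ℕ → ℂ} {c : ℂ} {C : ℝ}
    (h : ∀ᶠ n in atTop, ‖u n - n * c‖ ≤ C) : Tendsto (fun n : ℕ => u n / n) atTop (𝓝 c) := by
  rw [tendsto_iff_norm_sub_tendsto_zero]
  refine squeeze_zero' (.of_forall fun _ => norm_nonneg _) ?_ (tendsto_const_div_atTop_nhds_zero_nat C)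
  filter_upwards [h, eventually_ne_atTop 0] with n hn h0
  have h0' : (n : ℂ) ≠ 0 := by exact_mod_cast h0
  rw [show u n / n - c = (u n - n * c) / n by field_simp, norm_div, Complex.norm_natCast]
  gcongr

theorem trinomial_tendsto_moment {a : ℝ} (ha : a ∈ Set.Ioc (0 : ℝ) 2) {z : ∀ n, Fin n → ℂ}
    (hz : ∀ n, 2 ≤ n → Finset.univ.val.map (z n) = (trinomial n a).roots) (j k : ℕ) :
    Tendsto (fun n : ℕ => (∑ i, z n i ^ j * (starRingEnd ℂ (z n i)) ^ k) / n) atTop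
      (𝓝 (if j = k then 1 else 0)) := by
  have main (d k : ℕ) :
      Tendsto (fun n : ℕ => (∑ i, z n i ^ (d + k) * (starRingEnd ℂ (z n i)) ^ k) / n) atTop
        (𝓝 (if d = 0 then 1 else 0)) := by
    refine tendsto_div_nat_of_norm_sub_le
      (C := 3 ^ d * (((2 * k : ℕ) : ℝ) * 3 ^ (2 * k)) * (2 * Real.log 7)) ?_
    filter_upwards [eventually_ge_atTop (d + 2)] with n hn
    have hn2 : 2 ≤ n := by omega
    have h1 : ∑ i, z n i ^ d = n * (if d = 0 then 1 else 0) := by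
      split_ifs with hd
      · simp [hd]
      · rw [trinomial_sum_pow (hz n hn2) (Nat.pos_of_ne_zero hd) hn, mul_zero]
    rw [← h1]
    exact trinomial_sum_mixed_moment_sub_le hn2 ha (hz n hn2) d k
  rcases le_total k j with h | h
  · obtain ⟨d, rfl⟩ := Nat.exists_eq_add_of_le' h
    simpa using main d k
  · obtain ⟨d, rfl⟩ := Nat.exists_eq_add_of_le' h
    -- The case `j ≤ k` is the complex conjugate of the previous one.
    have := (Complex.continuous_conj.tendsto _).comp (main d j)
    convert! this using 2
    · simp [mul_comm]
    · split_ifs <;> simp <;> omega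

/-! ### Weak convergence from moments -/

/-- Stone–Weierstrass on the disc, with the approximant defined on all of `ℂ` so that it can be
integrated against measures on `ℂ`. -/
theorem exists_starPolynomial_near {R : ℝ} {f : ℂ → ℂ} (hf : Continuous f) {ε : ℝ} (hε : 0 < ε) :
    ∃ g ∈ Algebra.adjoin ℂ ({id, fun z => starRingEnd ℂ z} : Set (ℂ → ℂ)),
      ∀ z, ‖z‖ ≤ R → ‖f z - g z‖ < ε := by
  set K : Set ℂ := Metric.closedBall 0 R
  have : CompactSpace K := isCompact_iff_compactSpace.1 (isCompact_closedBall 0 R)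
  let F : C(K, ℂ) := ⟨fun z => f z, hf.comp continuous_subtype_val⟩
  have hF : F ∈ closure ((polynomialFunctions K).starClosure : Set C(K, ℂ)) := by
    rw [← StarSubalgebra.topologicalClosure_coe, polynomialFunctions.starClosure_topologicalClosure]
    trivial
  obtain ⟨q, hq, hFq⟩ := Metric.mem_closure_iff.1 hF ε hε
  have hrep : ∃ g ∈ Algebra.adjoin ℂ ({id, fun z => starRingEnd ℂ z} : Set (ℂ → ℂ)),
      ∀ z : K, q z = g z := by
    have hq' : q ∈ (polynomialFunctions K).starClosure := hq
    rw [polynomialFunctions.starClosure_eq_adjoin_X] at hq'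
    clear hq hFq
    induction hq' using Algebra.adjoin_induction with
    | mem q hq =>
      rcases hq with hq | hq
      · refine ⟨id, Algebra.subset_adjoin (by simp), fun z => ?_⟩
        rw [Set.mem_singleton_iff.1 hq]
        simp
      · refine ⟨fun z => starRingEnd ℂ z, Algebra.subset_adjoin (by simp), fun z => ?_⟩
        have : q = star (toContinuousMapOnAlgHom K X) := by
          rw [← Set.mem_singleton_iff.1 (Set.mem_star.1 hq), star_star]
        rw [this]
        simp
    | algebraMap r => exact ⟨algebraMap ℂ (ℂ → ℂ) r, Subalgebra.algebraMap_mem _ r, fun z => rfl⟩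
    | add p q _ _ hp hq =>
      obtain ⟨g, hg, hpg⟩ := hp
      obtain ⟨h, hh, hqh⟩ := hq
      exact ⟨g + h, add_mem hg hh, fun z => by simp [hpg, hqh]⟩
    | mul p q _ _ hp hq =>
      obtain ⟨g, hg, hpg⟩ := hp
      obtain ⟨h, hh, hqh⟩ := hq
      exact ⟨g * h, mul_mem hg hh, fun z => by simp [hpg, hqh]⟩
  obtain ⟨g, hg, hqg⟩ := hrep
  refine ⟨g, hg, fun z hz => ?_⟩
  have hzK : z ∈ K := by simpa [K] using hz
  rw [← hqg ⟨z, hzK⟩, ← dist_eq_norm]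
  exact (ContinuousMap.dist_apply_le_dist (f := F) (g := q) ⟨z, hzK⟩).trans_lt hFq

theorem continuous_of_mem_adjoin_id_conj {g : ℂ → ℂ}
    (hg : g ∈ Algebra.adjoin ℂ ({id, fun z => starRingEnd ℂ z} : Set (ℂ → ℂ))) :
    Continuous g := by
  induction hg using Algebra.adjoin_induction with
  | mem g hg =>
    rcases hg with rfl | rfl
    · exact continuous_id
    · exact Complex.continuous_conj
  | algebraMap r => exact continuous_const
  | add _ _ _ _ hp hq => exact hp.add hq
  | mul _ _ _ _ hp hq => exact hp.mul hq

theorem integrable_of_ae_norm_le {μ : Measure ℂ} [IsFiniteMeasure μ] {R : ℝ}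
    (hμ : ∀ᵐ z ∂μ, ‖z‖ ≤ R) {g : ℂ → ℂ} (hg : Continuous g) : Integrable g μ := by
  obtain ⟨C, hC⟩ := (isCompact_closedBall (0 : ℂ) R).exists_bound_of_continuousOn hg.continuousOn
  refine Integrable.of_bound hg.aestronglyMeasurable C ?_
  filter_upwards [hμ] with z hz using hC z (by simpa using hz)

theorem norm_integral_sub_le_of_near {μ : Measure ℂ} [IsProbabilityMeasure μ] {R : ℝ}
    (hμ : ∀ᵐ z ∂μ, ‖z‖ ≤ R) {f g : ℂ → ℂ} (hf : Continuous f) (hg : Continuous g) {ε : ℝ}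
    (h : ∀ z, ‖z‖ ≤ R → ‖f z - g z‖ < ε) : ‖∫ z, f z ∂μ - ∫ z, g z ∂μ‖ ≤ ε := by
  rw [← integral_sub (integrable_of_ae_norm_le hμ hf) (integrable_of_ae_norm_le hμ hg)]
  refine (norm_integral_le_of_norm_le_const (C := ε) ?_).trans (by simp)
  filter_upwards [hμ] with z hz using (h z hz).le

/-- Probability measures on a fixed disc converge weakly as soon as all their mixed moments do. -/
theorem tendsto_probabilityMeasure_of_moments {R : ℝ} {μs : ℕ → ProbabilityMeasure ℂ}
    {μ : ProbabilityMeasure ℂ} (hμs : ∀ n, ∀ᵐ z ∂(μs n : Measure ℂ), ‖z‖ ≤ R)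
    (hμ : ∀ᵐ z ∂(μ : Measure ℂ), ‖z‖ ≤ R)
    (h : ∀ j k : ℕ, Tendsto (fun n => ∫ z, z ^ j * (starRingEnd ℂ z) ^ k ∂(μs n : Measure ℂ)) atTop
      (𝓝 (∫ z, z ^ j * (starRingEnd ℂ z) ^ k ∂(μ : Measure ℂ)))) :
    Tendsto μs atTop (𝓝 μ) := by
  have hpoly : ∀ g ∈ Algebra.adjoin ℂ ({id, fun z => starRingEnd ℂ z} : Set (ℂ → ℂ)),
      Tendsto (fun n => ∫ z, g z ∂(μs n : Measure ℂ)) atTop (𝓝 (∫ z, g z ∂(μ : Measure ℂ))) := by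
    intro g hg
    rw [← Subalgebra.mem_toSubmodule, Algebra.adjoin_eq_span] at hg
    -- Continuity is carried through the induction to supply the integrability needed for sums.
    have hspan : Continuous g ∧ Tendsto (fun n => ∫ z, g z ∂(μs n : Measure ℂ)) atTop
        (𝓝 (∫ z, g z ∂(μ : Measure ℂ))) := by
      induction hg using Submodule.span_induction with
      | mem g hg =>
        obtain ⟨j, k, rfl⟩ := (Submonoid.mem_closure_pair _ _ _).1 hg
        exact ⟨(continuous_id.pow j).mul (Complex.continuous_conj.pow k), h j k⟩
      | zero => exact ⟨continuous_const, by simp⟩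
      | add p q _ _ hp hq =>
        refine ⟨hp.1.add hq.1, ?_⟩
        simp only [Pi.add_apply]
        rw [integral_add (integrable_of_ae_norm_le hμ hp.1) (integrable_of_ae_norm_le hμ hq.1)]
        refine (hp.2.add hq.2).congr fun n => ?_
        rw [integral_add (integrable_of_ae_norm_le (hμs n) hp.1)
          (integrable_of_ae_norm_le (hμs n) hq.1)]
      | smul c p _ hp =>
        refine ⟨hp.1.const_smul c, ?_⟩
        simp only [Pi.smul_apply, integral_smul]
        exact hp.2.const_smul c
    exact hspan.2
  refine (ProbabilityMeasure.tendsto_iff_forall_integral_rclike_tendsto ℂ).2 fun f => ?_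
  rw [Metric.tendsto_nhds]
  intro ε hε
  obtain ⟨g, hg, hfg⟩ := exists_starPolynomial_near (R := R) f.continuous
    (show 0 < ε / 3 by positivity)
  have hgc := continuous_of_mem_adjoin_id_conj hg
  filter_upwards [Metric.tendsto_nhds.1 (hpoly g hg) (ε / 3) (by positivity)] with n hn
  have h1 := norm_integral_sub_le_of_near (hμs n) f.continuous hgc hfg
  have h2 := norm_integral_sub_le_of_near hμ f.continuous hgc hfg
  rw [← dist_eq_norm] at h1 h2
  have h3 := dist_triangle4 (∫ z, f z ∂(μs n : Measure ℂ)) (∫ z, g z ∂(μs n : Measure ℂ))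
    (∫ z, g z ∂(μ : Measure ℂ)) (∫ z, f z ∂(μ : Measure ℂ))
  rw [dist_comm (∫ z, g z ∂(μ : Measure ℂ))] at h3
  linarith

/-! ### Uniform measure on the circle and its moments -/

/-- The uniform probability measure on the unit circle, as a measure on `ℂ`. -/
noncomputable def unitCircleMeasure : Measure ℂ :=
  ENNReal.ofReal (2 * Real.pi)⁻¹ •
    (volume.restrict (Set.Ioc (-Real.pi) Real.pi)).map fun θ : ℝ => Complex.exp (θ * Complex.I)

theorem measurable_exp_ofReal_mul_I : Measurable fun θ : ℝ => Complex.exp (θ * Complex.I) :=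
  Continuous.measurable (by fun_prop)

theorem unitCircleMeasure_apply {s : Set ℂ} (hs : MeasurableSet s) :
    unitCircleMeasure s = ENNReal.ofReal (2 * Real.pi)⁻¹ *
      volume ({θ : ℝ | Complex.exp (θ * Complex.I) ∈ s} ∩ Set.Ioc (-Real.pi) Real.pi) := by
  rw [unitCircleMeasure, Measure.smul_apply, Measure.map_apply measurable_exp_ofReal_mul_I hs,
    Measure.restrict_apply (measurable_exp_ofReal_mul_I hs), smul_eq_mul]
  rfl

instance : IsProbabilityMeasure unitCircleMeasure := by
  refine ⟨?_⟩
  rw [unitCircleMeasure_apply MeasurableSet.univ]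
  simp only [Set.mem_univ, Set.ofPred_true, Set.univ_inter, Real.volume_Ioc]
  rw [← ENNReal.ofReal_mul (by positivity), sub_neg_eq_add, ← two_mul,
    inv_mul_cancel₀ (by positivity), ENNReal.ofReal_one]

theorem ae_unitCircleMeasure_norm_eq_one : ∀ᵐ z ∂unitCircleMeasure, ‖z‖ = 1 := by
  refine Measure.ae_smul_measure ?_ _
  rw [ae_map_iff measurable_exp_ofReal_mul_I.aemeasurable
    (measurableSet_eq_fun measurable_norm measurable_const)]
  exact .of_forall fun θ => Complex.norm_exp_ofReal_mul_I θ

theorem integral_unitCircleMeasure {f : ℂ → ℂ} (hf : Continuous f) :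
    ∫ z, f z ∂unitCircleMeasure =
      (2 * Real.pi)⁻¹ * ∫ θ in (-Real.pi)..Real.pi, f (Complex.exp (θ * Complex.I)) := by
  rw [unitCircleMeasure, integral_smul_measure,
    integral_map measurable_exp_ofReal_mul_I.aemeasurable hf.aestronglyMeasurable,
    intervalIntegral.integral_of_le (by linarith [Real.pi_pos]),
    ENNReal.toReal_ofReal (by positivity), Complex.real_smul]

theorem integral_moment_unitCircleMeasure (j k : ℕ) :
    ∫ z, z ^ j * (starRingEnd ℂ z) ^ k ∂unitCircleMeasure = if j = k then 1 else 0 := by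
  rw [integral_unitCircleMeasure (by fun_prop)]
  have h : ∀ θ : ℝ, Complex.exp (θ * Complex.I) ^ j *
      (starRingEnd ℂ (Complex.exp (θ * Complex.I))) ^ k =
      Complex.exp (((j : ℂ) - k) * Complex.I * θ) := by
    intro θ
    rw [← Complex.exp_conj, ← Complex.exp_nat_mul, ← Complex.exp_nat_mul, ← Complex.exp_add]
    congr 1
    simp only [map_mul, Complex.conj_ofReal, Complex.conj_I]
    ring
  simp_rw [h]
  split_ifs with hjk
  · subst hjk
    have : (Real.pi : ℂ) ≠ 0 := by exact_mod_cast Real.pi_ne_zero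
    simp
    field_simp
    ring
  · have hc : ((j : ℂ) - k) * Complex.I ≠ 0 :=
      mul_ne_zero (sub_ne_zero.2 (by exact_mod_cast hjk)) Complex.I_ne_zero
    rw [integral_exp_mul_complex hc]
    have he : Complex.exp (((j : ℂ) - k) * Complex.I * (Real.pi : ℝ)) =
        Complex.exp (((j : ℂ) - k) * Complex.I * ((-Real.pi : ℝ) : ℂ)) := by
      rw [Complex.exp_eq_exp_iff_exists_int]
      refine ⟨(j : ℤ) - k, ?_⟩
      push_cast
      ring
    rw [he, sub_self, zero_div, mul_zero]

/-! ### The arc where `|1 + a z| > 1` -/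

theorem norm_sq_one_add_mul_exp (a θ : ℝ) :
    ‖1 + a * Complex.exp (θ * Complex.I)‖ ^ 2 = 1 + 2 * a * Real.cos θ + a ^ 2 := by
  rw [← Complex.normSq_eq_norm_sq, Complex.normSq_apply]
  simp only [Complex.add_re, Complex.add_im, Complex.one_re, Complex.one_im, Complex.re_ofReal_mul,
    Complex.im_ofReal_mul, Complex.exp_ofReal_mul_I_re, Complex.exp_ofReal_mul_I_im]
  nlinarith [Real.sin_sq_add_cos_sq θ]

theorem one_lt_norm_one_add_mul_exp_iff {a : ℝ} (ha : a ∈ Set.Ioc (0 : ℝ) 2) {θ : ℝ}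
    (hθ : |θ| ≤ Real.pi) :
    1 < ‖1 + a * Complex.exp (θ * Complex.I)‖ ↔ |θ| < Real.arccos (-a / 2) := by
  have hcos : Real.cos (Real.arccos (-a / 2)) = -a / 2 :=
    Real.cos_arccos (by linarith [ha.2]) (by linarith [ha.1])
  rw [← Real.strictAntiOn_cos.lt_iff_gt ⟨Real.arccos_nonneg _, Real.arccos_le_pi _⟩
    ⟨abs_nonneg θ, hθ⟩, hcos, Real.cos_abs, ← one_lt_sq_iff₀ (norm_nonneg _),
    norm_sq_one_add_mul_exp]
  constructor <;> intro h <;> nlinarith [ha.1]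

theorem norm_one_add_mul_exp_eq_one_iff {a : ℝ} (ha : a ∈ Set.Ioc (0 : ℝ) 2) {θ : ℝ}
    (hθ : |θ| ≤ Real.pi) :
    ‖1 + a * Complex.exp (θ * Complex.I)‖ = 1 ↔ |θ| = Real.arccos (-a / 2) := by
  have hcos : Real.cos (Real.arccos (-a / 2)) = -a / 2 :=
    Real.cos_arccos (by linarith [ha.2]) (by linarith [ha.1])
  rw [← Real.injOn_cos.eq_iff ⟨abs_nonneg θ, hθ⟩ ⟨Real.arccos_nonneg _, Real.arccos_le_pi _⟩,
    hcos, Real.cos_abs, ← pow_eq_one_iff_of_nonneg (norm_nonneg _) two_ne_zero,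
    norm_sq_one_add_mul_exp]
  have ha0 := ha.1.ne'
  constructor
  · intro h
    apply mul_left_cancel₀ ha0
    linarith
  · intro h
    rw [h]
    ring

theorem unitCircleMeasure_one_lt_norm {a : ℝ} (ha : a ∈ Set.Ioc (0 : ℝ) 2) :
    unitCircleMeasure {z | 1 < ‖1 + a * z‖} =
      ENNReal.ofReal (1 / Real.pi * Real.arccos (-a / 2)) := by
  have hset : {θ : ℝ | Complex.exp (θ * Complex.I) ∈ {z : ℂ | 1 < ‖1 + a * z‖}} ∩
      Set.Ioc (-Real.pi) Real.pi = Set.Ioo (-Real.arccos (-a / 2)) (Real.arccos (-a / 2)) := by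
    ext θ
    simp only [Set.mem_inter_iff, Set.mem_ofPred_eq, Set.mem_Ioc, Set.mem_Ioo, ← abs_lt]
    have hle := Real.arccos_le_pi (-a / 2)
    constructor
    · rintro ⟨h, h1, h2⟩
      exact (one_lt_norm_one_add_mul_exp_iff ha (abs_le.2 ⟨h1.le, h2⟩)).1 h
    · intro h
      have h' := abs_lt.1 (h.trans_le hle)
      exact ⟨(one_lt_norm_one_add_mul_exp_iff ha (h.trans_le hle).le).2 h, h'.1, h'.2.le⟩
  rw [unitCircleMeasure_apply (isOpen_lt (by fun_prop) (by fun_prop)).measurableSet, hset,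
    Real.volume_Ioo, ← ENNReal.ofReal_mul (by positivity)]
  congr 1
  field_simp
  ring

/-- The frontier meets the circle only at the angles `±arccos (-a/2)`. -/
theorem unitCircleMeasure_frontier {a : ℝ} (ha : a ∈ Set.Ioc (0 : ℝ) 2) :
    unitCircleMeasure (frontier {z | 1 < ‖1 + a * z‖}) = 0 := by
  refine measure_mono_null (frontier_lt_subset_eq (by fun_prop) (by fun_prop)) ?_
  rw [unitCircleMeasure_apply (isClosed_eq (by fun_prop) (by fun_prop)).measurableSet]
  refine mul_eq_zero_of_right _ (measure_mono_null (t :=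
    {Real.arccos (-a / 2), -Real.arccos (-a / 2)}) ?_ (Set.Finite.measure_zero (by simp) _))
  rintro θ ⟨h, h1, h2⟩
  exact eq_or_eq_neg_of_abs_eq
    ((norm_one_add_mul_exp_eq_one_iff ha (abs_le.2 ⟨h1.le, h2⟩)).1 (Eq.symm h))

/-! ### Empirical measures and the conclusion -/

/-- The uniform probability measure on a finite family of points. -/
noncomputable def empiricalMeasure {ι : Type*} [Fintype ι] (z : ι → ℂ) : Measure ℂ :=
  (Fintype.card ι : ENNReal)⁻¹ • ∑ i, Measure.dirac (z i)

section empirical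

variable {ι : Type*} [Fintype ι] (z : ι → ℂ)

instance [Nonempty ι] : IsProbabilityMeasure (empiricalMeasure z) := by
  refine ⟨?_⟩
  simp [empiricalMeasure, ENNReal.inv_mul_cancel]

theorem ae_empiricalMeasure {p : ℂ → Prop} (hp : MeasurableSet {x | p x}) (h : ∀ i, p (z i)) :
    ∀ᵐ x ∂empiricalMeasure z, p x := by
  refine Measure.ae_smul_measure ?_ _
  rw [ae_iff, Measure.finsetSum_apply]
  refine Finset.sum_eq_zero fun i _ => ?_
  rw [← ae_iff, ae_dirac_iff hp]
  exact h i

theorem integral_empiricalMeasure (f : ℂ → ℂ) :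
    ∫ x, f x ∂empiricalMeasure z = (∑ i, f (z i)) / Fintype.card ι := by
  rw [empiricalMeasure, integral_smul_measure, integral_finsetSum_measure]
  · simp [Complex.real_smul, div_eq_inv_mul]
  · exact fun i _ => integrable_dirac (by simp)

theorem empiricalMeasure_apply {s : Set ℂ} (hs : MeasurableSet s) [DecidablePred fun i => z i ∈ s] :
    (empiricalMeasure z s).toReal =
      (Finset.univ.filter fun i => z i ∈ s).card / (Fintype.card ι : ℝ) := by
  classical
  rw [empiricalMeasure, Measure.smul_apply, Measure.finsetSum_apply]
  simp_rw [Measure.dirac_apply' _ hs]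
  simp [Set.indicator_apply, Finset.sum_boole, div_eq_inv_mul]

end empirical

theorem nu_eq_card_filter {n : ℕ} (hn : 2 ≤ n) {a : ℝ} {z : Fin n → ℂ}
    (hz : Finset.univ.val.map z = (trinomial n a).roots)
    [DecidablePred fun i => z i ∈ {x : ℂ | 1 < ‖1 + a * x‖}] :
    nu n a = (Finset.univ.filter fun i => z i ∈ {x : ℂ | 1 < ‖1 + a * x‖}).card := by
  classical
  rw [nu, ← hz, Multiset.filter_map, Multiset.card_map, Finset.card_def, Finset.filter_val]
  congr 1
  refine Multiset.filter_congr fun i _ => ?_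
  rw [Set.mem_ofPred_eq, ← trinomial_root_eq hz i, norm_pow, Function.comp_apply,
    one_lt_pow_iff_of_nonneg (norm_nonneg _) (by omega)]

theorem theorem1p1 (a : ℝ) (ha : a ∈ Set.Ioc (0 : ℝ) 2) :
    Tendsto (fun n : ℕ => (nu n a : ℝ) / (n : ℝ)) atTop
      (𝓝 (1 / Real.pi * Real.arccos (-a / 2))) := by
  classical
  have hex : ∀ n, ∃ z : Fin n → ℂ, 2 ≤ n → Finset.univ.val.map z = (trinomial n a).roots := by
    intro n
    by_cases hn : 2 ≤ n
    · obtain ⟨z, hz⟩ := trinomial_exists_roots hn a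
      exact ⟨z, fun _ => hz⟩
    · exact ⟨0, fun h => absurd h hn⟩
  choose z hz using hex
  -- The shift by `2` makes the index type nonempty and the root description available for every
  -- `n`.
  let μs : ℕ → ProbabilityMeasure ℂ := fun n => ⟨empiricalMeasure (z (n + 2)), inferInstance⟩
  let μ : ProbabilityMeasure ℂ := ⟨unitCircleMeasure, inferInstance⟩
  have hlim : Tendsto μs atTop (𝓝 μ) := by
    refine tendsto_probabilityMeasure_of_moments (R := 3) (fun n => ?_) ?_ fun j k => ?_
    · have hn : 2 ≤ n + 2 := by omega
      exact ae_empiricalMeasure _ (measurableSet_le measurable_norm measurable_const) fun i =>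
        norm_le_three_of_pow_eq hn ha (trinomial_root_eq (hz _ hn) i)
    · filter_upwards [ae_unitCircleMeasure_norm_eq_one] with x hx
      rw [hx]
      norm_num
    · have h := (tendsto_add_atTop_iff_nat 2).2 (trinomial_tendsto_moment ha hz j k)
      change Tendsto (fun n => ∫ x, x ^ j * (starRingEnd ℂ x) ^ k ∂empiricalMeasure (z (n + 2)))
        atTop (𝓝 (∫ x, x ^ j * (starRingEnd ℂ x) ^ k ∂unitCircleMeasure))
      rw [integral_moment_unitCircleMeasure]
      refine h.congr fun n => ?_
      rw [integral_empiricalMeasure, Fintype.card_fin]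
  have hE : MeasurableSet {x : ℂ | 1 < ‖1 + a * x‖} :=
    (isOpen_lt (by fun_prop) (by fun_prop)).measurableSet
  have hE' := ProbabilityMeasure.tendsto_measure_of_null_frontier_of_tendsto' hlim
    (E := {x : ℂ | 1 < ‖1 + a * x‖}) (unitCircleMeasure_frontier ha)
  have hreal := (ENNReal.tendsto_toReal (measure_ne_top _ _)).comp hE'
  change Tendsto _ _ (𝓝 (unitCircleMeasure {x : ℂ | 1 < ‖1 + a * x‖}).toReal) at hreal
  rw [unitCircleMeasure_one_lt_norm ha, ENNReal.toReal_ofReal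
    (mul_nonneg (by positivity) (Real.arccos_nonneg _))] at hreal
  rw [← tendsto_add_atTop_iff_nat 2]
  refine hreal.congr fun n => ?_
  change (empiricalMeasure (z (n + 2)) _).toReal = _
  have hn : 2 ≤ n + 2 := by omega
  rw [empiricalMeasure_apply _ hE, Fintype.card_fin, nu_eq_card_filter hn (hz _ hn)]
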